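/- Let $(\Omega,\mu)$ be a $\sigma$-finite measure space with a non-atomic measure $\mu$, and let $\mathcal M(\Omega,\mu)$ be the space of all (real- or complex-valued) $\mu$-measurable functions on $\Omega$, where functions equal $\mu$-a.e. are identified. For $f\in\mathcal M(\Omega,\mu)$ let $f^*(t)=\inf\{\lambda\ge 0:\mu(\{|f|>\lambda\})\le t\}$ ($t>0$) be its non-increasing rearrangement. Write $\|\cdot\|_{q,I}$ for the (quasi-)norm of $L_q(I)$ on an interval $I\subseteq(0,\infty)$, with the convention $1/\infty=0$. For $0<\kappa<\infty$ let $L_\kappa$ and $L_\infty$ be the Lebesgue spaces on $(\Omega,\mu)$, and let $L_{\kappa,\infty}$ be the space of all $f\in\mathcal M(\Omega,\mu)$ with $\|f\|_{\kappa,\infty}=\sup_{t>0}t^{1/\kappa}f^*(t)<\infty$. A Lebesgue measurable function $b:(0,\infty)\to(0,\infty)$ is called slowly varying ($b\in SV$) if for every $\varepsilon>0$ the function $t\mapsto t^{\varepsilon}b(t)$ is equivalent to a non-decreasing function and $t\mapsto t^{-\varepsilon}b(t)$ is equivalent to a non-increasing function; here $g\approx h$ means $C^{-1}h\le g\le Ch$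 on $(0,\infty)$ for some constant $C>0$. For a couple $(A_0,A_1)$ of quasi-normed spaces contained in $\mathcal M(\Omega,\mu)$, $f\in A_0+A_1$ and $t>0$, let $$K(t,f;A_0,A_1)=\inf\{\|f_0\|_{A_0}+t\|f_1\|_{A_1}: f=f_0+f_1,\ f_i\in A_i\}.$$ For $0\le\theta\le1$, $0<q,r,s\le\infty$ and $a,b,c\in SV$, the extremal interpolation space $(A_0,A_1)^{\mathcal R,\mathcal L}_{\theta,s,c,r,b,q,a}$ consists of all $f\in A_0+A_1$ for which the quasi-norm $$\bigg\|t^{-\frac1s}c(t)\Big\|u^{-\frac1r}b(u)\big\|v^{-\theta-\frac1q}a(v)K(v,f;A_0,A_1)\big\|_{q,(u,t)}\Big\|_{r,(0,t)}\bigg\|_{s,(0,\infty)}$$ is finite. For $0<p\le\infty$, the space $L^{\mathcal R,\mathcal L}_{p,(s,c,r,b,q,a)}$ consists of all $f\in\mathcal M(\Omega,\mu)$ for which the quasi-norm $$\bigg\|t^{-\frac1s}c(t)\Big\|u^{-\frac1r}b(u)\big\|v^{\frac1p-\frac1q}a(v)f^*(v)\big\|_{q,(u,t)}\Big\|_{r,(0,t)}\bigg\|_{s,(0,\infty)}$$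 is finite. **Theorem.** Let $0<\theta\le1$, $0<\kappa<\infty$, $p=\frac{\kappa}{1-\theta}$ (so $p=\infty$ if $\theta=1$), $0<q,r,s\le\infty$ and $a,b,c\in SV$. Put $\tilde a(t)=a(t^{1/\kappa})$, $\tilde b(t)=b(t^{1/\kappa})$ and $\tilde c(t)=c(t^{1/\kappa})$ for $t>0$. Then $$(L_\kappa,L_\infty)^{\mathcal R,\mathcal L}_{\theta,s,c,r,b,q,a}=(L_{\kappa,\infty},L_\infty)^{\mathcal R,\mathcal L}_{\theta,s,c,r,b,q,a}=L^{\mathcal R,\mathcal L}_{p,(s,\tilde c,r,\tilde b,q,\tilde a)},$$ where equality of spaces means that they consist of the same functions and that their quasi-norms are equivalent. -/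

import Mathlib

open MeasureTheory Set
open scoped ENNReal

namespace RLInterp

noncomputable section

/-- A measure without atoms in the measure-theoretic sense: every measurable set of positive
measure splits into two measurable pieces of positive measure.
(The Mathlib class `NoAtoms` only says that singletons are null.) -/
def NonAtomic {Ω : Type*} [MeasurableSpace Ω] (μ : Measure Ω) : Prop :=
  ∀ A : Set Ω, MeasurableSet A → μ A ≠ 0 →
    ∃ B : Set Ω, B ⊆ A ∧ MeasurableSet B ∧ μ B ≠ 0 ∧ μ (A \ B) ≠ 0

/-- Equivalence of two functions on `(0,∞)`, up to a multiplicative constant. -/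
def EquivOn (f g : ℝ → ℝ) : Prop :=
  ∃ C : ℝ, 0 < C ∧ ∀ t : ℝ, 0 < t → f t ≤ C * g t ∧ g t ≤ C * f t

/-- Slowly varying functions on `(0,∞)`; the values of `b` outside `(0,∞)` play no role. -/
structure SlowlyVarying (b : ℝ → ℝ) : Prop where
  pos : ∀ t : ℝ, 0 < t → 0 < b t
  measurable : AEMeasurable b (volume.restrict (Ioi (0 : ℝ)))
  equiv_increasing : ∀ ε : ℝ, 0 < ε →
    ∃ g : ℝ → ℝ, MonotoneOn g (Ioi 0) ∧ EquivOn (fun t => t ^ ε * b t) g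
  equiv_decreasing : ∀ ε : ℝ, 0 < ε →
    ∃ g : ℝ → ℝ, AntitoneOn g (Ioi 0) ∧ EquivOn (fun t => t ^ (-ε) * b t) g

/-- The weighted `L_q` (quasi-)norm `‖ u ^ (σ - 1/q) * b u * g u ‖_{q, I}` over a set `I ⊆ (0,∞)`,
where `1/∞ = 0`. -/
def wnorm (q : ℝ≥0∞) (σ : ℝ) (b : ℝ → ℝ) (I : Set ℝ) (g : ℝ → ℝ≥0∞) : ℝ≥0∞ :=
  eLpNorm (fun u : ℝ => ENNReal.ofReal (u ^ (σ - (q⁻¹).toReal) * b u) * g u) q (volume.restrict I)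

/-- The iterated quantity
`‖ t^(-1/s) c(t) ‖ u^(-1/r) b(u) ‖ v^(σ-1/q) a(v) g(v) ‖_{q,(u,t)} ‖_{r,(0,t)} ‖_{s,(0,∞)}`. -/
def normRL (σ : ℝ) (s : ℝ≥0∞) (c : ℝ → ℝ) (r : ℝ≥0∞) (b : ℝ → ℝ) (q : ℝ≥0∞) (a : ℝ → ℝ)
    (g : ℝ → ℝ≥0∞) : ℝ≥0∞ :=
  wnorm s 0 c (Ioi 0) fun t =>
    wnorm r 0 b (Ioo 0 t) fun u =>
      wnorm q σ a (Ioo u t) g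

section Spaces

variable {Ω : Type*} [MeasurableSpace Ω]

/-- A space of (classes of) measurable functions together with a quasi-norm. The linear structure
is the one of the space `Ω →ₘ[μ] 𝕜` of all classes of measurable functions. -/
structure FunctionSpace (𝕜 : Type*) [RCLike 𝕜] (μ : Measure Ω) where
  carrier : Set (Ω →ₘ[μ] 𝕜)
  qnorm : (Ω →ₘ[μ] 𝕜) → ℝ≥0∞

variable {𝕜 : Type*} [RCLike 𝕜] {μ : Measure Ω}

/-- Continuous embedding. -/
def FunctionSpace.Embeds (X Y : FunctionSpace 𝕜 μ) : Prop :=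
  X.carrier ⊆ Y.carrier ∧
    ∃ C : ℝ, 0 < C ∧ ∀ f ∈ X.carrier, Y.qnorm f ≤ ENNReal.ofReal C * X.qnorm f

/-- Equality of spaces: the same functions, with equivalent quasi-norms. -/
def FunctionSpace.Same (X Y : FunctionSpace 𝕜 μ) : Prop :=
  X.Embeds Y ∧ Y.Embeds X

/-- The space of all measurable functions for which a given functional is finite. -/
def FunctionSpace.ofFinite (N : (Ω →ₘ[μ] 𝕜) → ℝ≥0∞) : FunctionSpace 𝕜 μ where
  carrier := {f | N f < ∞}
  qnorm := N

/-- The non-increasing rearrangement `f*(t) = inf {l ≥ 0 : μ {|f| > l} ≤ t}`. -/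
def rearr (f : Ω →ₘ[μ] 𝕜) (t : ℝ) : ℝ≥0∞ :=
  sInf {l : ℝ≥0∞ | μ {x | l < ‖f x‖ₑ} ≤ ENNReal.ofReal t}

variable (𝕜 μ)

/-- The Lebesgue space `L_p`, `0 < p ≤ ∞`. -/
def Leb (p : ℝ≥0∞) : FunctionSpace 𝕜 μ :=
  .ofFinite fun f => eLpNorm f p μ

/-- The weak Lebesgue space `L_{k,∞}`, with quasi-norm `sup_{t > 0} t^(1/k) f*(t)`. -/
def WeakLeb (k : ℝ) : FunctionSpace 𝕜 μ :=
  .ofFinite fun f => ⨆ (t : ℝ) (_ : 0 < t), ENNReal.ofReal (t ^ (1 / k)) * rearr f t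

/-- The Lorentz-Karamata space of type `RL`, with its quasi-norm
`‖ t^(-1/s) c(t) ‖ u^(-1/r) b(u) ‖ v^(1/p-1/q) a(v) f*(v) ‖_{q,(u,t)} ‖_{r,(0,t)} ‖_{s,(0,∞)}`,
where `1/∞ = 0`. -/
def LorentzKaramataRL (p s : ℝ≥0∞) (c : ℝ → ℝ) (r : ℝ≥0∞) (b : ℝ → ℝ) (q : ℝ≥0∞) (a : ℝ → ℝ) :
    FunctionSpace 𝕜 μ :=
  .ofFinite fun f => normRL (p⁻¹).toReal s c r b q a (rearr f)

variable {𝕜 μ}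

/-- The Peetre `K`-functional of a couple `(A₀, A₁)`. -/
def peetreK (A₀ A₁ : FunctionSpace 𝕜 μ) (f : Ω →ₘ[μ] 𝕜) (t : ℝ) : ℝ≥0∞ :=
  ⨅ (f₀ ∈ A₀.carrier) (f₁ ∈ A₁.carrier) (_ : f = f₀ + f₁),
    A₀.qnorm f₀ + ENNReal.ofReal t * A₁.qnorm f₁

/-- The extremal interpolation space of type `RL` of a couple `(A₀, A₁)`: all `f ∈ A₀ + A₁` for
which
`‖ t^(-1/s) c(t) ‖ u^(-1/r) b(u) ‖ v^(-θ-1/q) a(v) K(v,f) ‖_{q,(u,t)} ‖_{r,(0,t)} ‖_{s,(0,∞)}`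
is finite. -/
def extremalRL (A₀ A₁ : FunctionSpace 𝕜 μ) (θ : ℝ) (s : ℝ≥0∞) (c : ℝ → ℝ) (r : ℝ≥0∞) (b : ℝ → ℝ)
    (q : ℝ≥0∞) (a : ℝ → ℝ) : FunctionSpace 𝕜 μ where
  carrier := {f | (∃ f₀ ∈ A₀.carrier, ∃ f₁ ∈ A₁.carrier, f = f₀ + f₁) ∧
    normRL (-θ) s c r b q a (peetreK A₀ A₁ f) < ∞}
  qnorm := fun f => normRL (-θ) s c r b q a (peetreK A₀ A₁ f)

end Spaces

end

end RLInterp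

/-!
Both inequalities in
`t f*(t ^ κ) ≤ K(t, f; L_{κ,∞}, L_∞) ≤ K(t, f; L_κ, L_∞)` are elementary. Conversely, cutting `f`
at the levels `f*((t / 2 ^ j) ^ κ)` into dyadic layers gives, for every `ε > 0`,
`K(t, f; L_κ, L_∞) ≤ C sup_j 2 ^ (j ε) (t / 2 ^ j) f*((t / 2 ^ j) ^ κ)`.
Dilating by `2 ^ (-j)` multiplies the norm of the interpolation space by at most a constant times
`2 ^ (j (α + β - θ))` when `a` and `b` have upper types `α` and `β`, so if `α + β < θ` and `ε` is
small, the dilates sum like a convergent geometric series and the supremum is harmless. Hence both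
`K`-functionals may be replaced by `t f*(t ^ κ)`, whose norm becomes the Lorentz-Karamata
quasi-norm under the substitution `v = w ^ κ`.
-/

namespace RLInterp

open scoped NNReal

section ELpNorm

variable {α : Type*} [MeasurableSpace α] {μ : Measure α} {q : ℝ≥0∞}

theorem eLpNorm_ennreal_const_mul {K : ℝ≥0∞} (hK : K ≠ ∞) (f : α → ℝ≥0∞) :
    eLpNorm (fun x => K * f x) q μ = K * eLpNorm f q μ := by
  rcases eq_or_ne q 0 with rfl | h0
  · simp
  rcases eq_or_ne q ∞ with rfl | ht
  · simp [eLpNormEssSup_eq_essSup_enorm, ENNReal.essSup_const_mul]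
  have hq : 0 < q.toReal := ENNReal.toReal_pos h0 ht
  simp only [eLpNorm_eq_lintegral_rpow_enorm_toReal h0 ht, enorm_eq_self,
    ENNReal.mul_rpow_of_nonneg _ _ hq.le]
  rw [lintegral_const_mul' _ _ (by finiteness), ENNReal.mul_rpow_of_nonneg _ _ (by positivity),
    ← ENNReal.rpow_mul, mul_one_div_cancel hq.ne', ENNReal.rpow_one]

theorem eLpNorm_withDensity {w : α → ℝ≥0∞} (hw : AEMeasurable w μ) (hw₀ : ∀ᵐ x ∂μ, w x ≠ 0)
    (hw_top : ∀ᵐ x ∂μ, w x < ∞) (f : α → ℝ≥0∞) :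
    eLpNorm f q (μ.withDensity w) = eLpNorm (fun x => w x ^ (q⁻¹).toReal * f x) q μ := by
  rcases eq_or_ne q 0 with rfl | h0
  · simp
  rcases eq_or_ne q ∞ with rfl | ht
  · simp only [eLpNorm_exponent_top, ENNReal.inv_top, ENNReal.toReal_zero, ENNReal.rpow_zero,
      one_mul]
    exact le_antisymm (eLpNormEssSup_mono_measure f (withDensity_absolutelyContinuous μ w))
      (eLpNormEssSup_mono_measure f (withDensity_absolutelyContinuous' hw hw₀))
  have hq : 0 < q.toReal := ENNReal.toReal_pos h0 ht
  simp only [eLpNorm_eq_lintegral_rpow_enorm_toReal h0 ht, enorm_eq_self,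
    ENNReal.mul_rpow_of_nonneg _ _ hq.le, ENNReal.toReal_inv, ← ENNReal.rpow_mul,
    inv_mul_cancel₀ hq.ne', ENNReal.rpow_one]
  rw [lintegral_withDensity_eq_lintegral_mul_non_measurable₀ μ hw hw_top]
  simp only [Pi.mul_apply]

theorem eLpNorm_restrict_image {E : Type*} [NormedAddCommGroup E] [NormedSpace ℝ E]
    [FiniteDimensional ℝ E] [MeasurableSpace E] [BorelSpace E] (μ : Measure E) [μ.IsAddHaarMeasure]
    {φ : E → E} {φ' : E → E →L[ℝ] E} {s : Set E} (hs : MeasurableSet s)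
    (hφ : ∀ x ∈ s, HasFDerivWithinAt φ (φ' x) s x) (hinj : InjOn φ s)
    (hdet : ∀ x ∈ s, (φ' x).det ≠ 0) (f : E → ℝ≥0∞) :
    eLpNorm f q (μ.restrict (φ '' s)) =
      eLpNorm (fun x => ENNReal.ofReal |(φ' x).det| ^ (q⁻¹).toReal * f (φ x)) q
        (μ.restrict s) := by
  rw [← restrict_map_withDensity_abs_det_fderiv_eq_addHaar μ hs hφ hinj,
    (measurableEmbedding_of_fderivWithin hs hφ hinj).eLpNorm_map_measure,
    show f ∘ s.domRestrict φ = (f ∘ φ) ∘ ((↑) : s → E) from rfl,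
    ← (MeasurableEmbedding.subtype_coe hs).eLpNorm_map_measure, map_comap_subtype_coe hs,
    restrict_withDensity hs, eLpNorm_withDensity]
  · rfl
  · exact aemeasurable_ofReal_abs_det_fderivWithin μ hs hφ
  · filter_upwards [ae_restrict_mem hs] with x hx
    simpa using hdet x hx
  · exact Filter.Eventually.of_forall fun _ => ENNReal.ofReal_lt_top

theorem exists_tsum_rpow_le {q δ : ℝ} (hq : 0 < q) (hδ : 0 < δ) :
    ∃ C : ℝ≥0, ∀ x : ℕ → ℝ≥0∞,
      (∑' j, x j ^ q) ^ (1 / q) ≤ C * ⨆ j : ℕ, 2 ^ (j * δ) * x j := by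
  set ρ : ℝ≥0∞ := 2 ^ (-δ * q) with hρ
  have hρ_lt : ρ < 1 :=
    ENNReal.rpow_lt_one_of_one_lt_of_neg (by norm_num) (by nlinarith)
  have hC : ((1 - ρ)⁻¹) ^ (1 / q) ≠ ∞ :=
    ENNReal.rpow_ne_top_of_nonneg (by positivity)
      (ENNReal.inv_ne_top.2 (tsub_pos_of_lt hρ_lt).ne')
  refine ⟨(((1 - ρ)⁻¹) ^ (1 / q)).toNNReal, fun x => ?_⟩
  rw [ENNReal.coe_toNNReal hC]
  set S := ⨆ j : ℕ, (2 : ℝ≥0∞) ^ (j * δ) * x j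
  have hx (j : ℕ) : x j ^ q ≤ ρ ^ j * S ^ q := by
    calc x j ^ q = (2 ^ (-(j * δ)) * (2 ^ (j * δ) * x j)) ^ q := by
          rw [← mul_assoc, ← ENNReal.rpow_add _ _ two_ne_zero ENNReal.ofNat_ne_top,
            neg_add_cancel, ENNReal.rpow_zero, one_mul]
      _ ≤ (2 ^ (-(j * δ)) * S) ^ q := by
          gcongr
          exact le_iSup (fun j : ℕ => (2 : ℝ≥0∞) ^ (j * δ) * x j) j
      _ = ρ ^ j * S ^ q := by
          rw [ENNReal.mul_rpow_of_nonneg _ _ hq.le, hρ, ← ENNReal.rpow_natCast,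
            ← ENNReal.rpow_mul, ← ENNReal.rpow_mul]
          ring_nf
  calc (∑' j, x j ^ q) ^ (1 / q) ≤ (∑' j, ρ ^ j * S ^ q) ^ (1 / q) := by
        gcongr with j
        exact hx j
    _ = ((1 - ρ)⁻¹) ^ (1 / q) * S := by
        rw [ENNReal.tsum_mul_right, ENNReal.tsum_geometric,
          ENNReal.mul_rpow_of_nonneg _ _ (by positivity), ← ENNReal.rpow_mul,
          mul_one_div_cancel hq.ne', ENNReal.rpow_one]

theorem iSup_rpow_le_tsum {ι : Type*} {q : ℝ} (hq : 0 < q) (x : ι → ℝ≥0∞) :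
    (⨆ j, x j) ^ q ≤ ∑' j, x j ^ q := by
  rw [← ENNReal.le_rpow_inv_iff hq]
  exact iSup_le fun j => (ENNReal.le_rpow_inv_iff hq).2 (ENNReal.le_tsum j)

theorem exists_eLpNorm_iSup_le (q : ℝ≥0∞) {δ : ℝ} (hδ : 0 < δ) :
    ∃ C : ℝ≥0, ∀ (μ : Measure α) (f : ℕ → α → ℝ≥0∞), (∀ j, AEMeasurable (f j) μ) →
      eLpNorm (fun x => ⨆ j, f j x) q μ ≤ C * ⨆ j : ℕ, 2 ^ (j * δ) * eLpNorm (f j) q μ := by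
  rcases eq_or_ne q 0 with rfl | hq
  · exact ⟨0, by simp⟩
  rcases eq_or_ne q ∞ with rfl | ht
  · refine ⟨1, fun μ f _ => ?_⟩
    simp only [eLpNorm_exponent_top, eLpNormEssSup_eq_essSup_enorm, enorm_eq_self,
      ENNReal.coe_one, one_mul]
    refine essSup_le_of_ae_le _ ?_
    filter_upwards [ae_all_iff.2 fun j => ENNReal.ae_le_essSup (μ := μ) (f j)] with x hx
    refine iSup_mono fun j => (hx j).trans (le_mul_of_one_le_left' ?_)
    simpa using ENNReal.rpow_le_rpow_of_exponent_le (x := 2) one_le_two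
      (by positivity : 0 ≤ j * δ)
  have hq' : 0 < q.toReal := ENNReal.toReal_pos hq ht
  obtain ⟨C, hC⟩ := exists_tsum_rpow_le hq' hδ
  refine ⟨C, fun μ f hf => le_trans ?_ (hC _)⟩
  simp only [eLpNorm_eq_lintegral_rpow_enorm_toReal hq ht, enorm_eq_self, ← ENNReal.rpow_mul,
    one_div_mul_cancel hq'.ne', ENNReal.rpow_one]
  rw [← lintegral_tsum fun j => (hf j).pow_const _]
  gcongr with x
  exact iSup_rpow_le_tsum hq' _

end ELpNorm

section WNorm

variable {q : ℝ≥0∞} {σ τ : ℝ} {a b : ℝ → ℝ} {I J : Set ℝ} {f g : ℝ → ℝ≥0∞}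

theorem wnorm_congr (hI : MeasurableSet I)
    (h : ∀ u ∈ I, ENNReal.ofReal (u ^ (σ - (q⁻¹).toReal) * a u) * f u =
      ENNReal.ofReal (u ^ (τ - (q⁻¹).toReal) * b u) * g u) :
    wnorm q σ a I f = wnorm q τ b I g := by
  refine eLpNorm_congr_enorm_ae ?_
  filter_upwards [ae_restrict_mem hI] with u hu
  rw [h u hu]

theorem wnorm_mono (hI : MeasurableSet I)
    (h : ∀ u ∈ I, ENNReal.ofReal (u ^ (σ - (q⁻¹).toReal) * a u) * f u ≤
      ENNReal.ofReal (u ^ (τ - (q⁻¹).toReal) * b u) * g u) :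
    wnorm q σ a I f ≤ wnorm q τ b I g := by
  refine eLpNorm_mono_enorm_ae ?_
  filter_upwards [ae_restrict_mem hI] with u hu
  simpa only [enorm_eq_self] using h u hu

theorem wnorm_congr_fun (hI : MeasurableSet I) (h : EqOn f g I) :
    wnorm q σ a I f = wnorm q σ a I g :=
  wnorm_congr hI fun _ hu => by rw [h hu]

theorem wnorm_mono_fun (hI : MeasurableSet I) (h : ∀ u ∈ I, f u ≤ g u) :
    wnorm q σ a I f ≤ wnorm q σ a I g :=
  wnorm_mono hI fun u hu => by gcongr; exact h u hu

theorem wnorm_mono_set (h : I ⊆ J) : wnorm q σ a I f ≤ wnorm q σ a J f :=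
  eLpNorm_mono_measure _ (Measure.restrict_mono h le_rfl)

theorem wnorm_const_mul {K : ℝ≥0∞} (hK : K ≠ ∞) :
    wnorm q σ a I (fun u => K * f u) = K * wnorm q σ a I f := by
  simp only [wnorm, ← eLpNorm_ennreal_const_mul hK, mul_left_comm]

theorem wnorm_le_const_mul (hI : MeasurableSet I) {K : ℝ≥0∞} (hK : K ≠ ∞)
    (h : ∀ u ∈ I, f u ≤ K * g u) : wnorm q σ a I f ≤ K * wnorm q σ a I g :=
  (wnorm_mono_fun hI h).trans (wnorm_const_mul hK).le

theorem wnorm_top (hq : q ≠ 0) (ha : ∀ t ∈ I, 0 < a t) (hI : MeasurableSet I) (hI₀ : I ⊆ Ioi 0)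
    (hI_ne : volume I ≠ 0) : wnorm q σ a I (fun _ => ∞) = ∞ := by
  have h_const : wnorm q σ a I (fun _ => ∞) =
      eLpNorm (fun _ : ℝ => (∞ : ℝ≥0∞)) q (volume.restrict I) := by
    refine eLpNorm_congr_enorm_ae ?_
    filter_upwards [ae_restrict_mem hI] with u hu
    have hw : 0 < u ^ (σ - (q⁻¹).toReal) * a u :=
      mul_pos (Real.rpow_pos_of_pos (hI₀ hu) _) (ha u hu)
    rw [ENNReal.mul_top (ENNReal.ofReal_pos.2 hw).ne']
  rw [h_const, eLpNorm_const _ hq (by simpa [Measure.restrict_eq_zero] using hI_ne)]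
  exact ENNReal.top_mul (by simp [hI_ne])

theorem wnorm_ofReal_mul (hI : MeasurableSet I) (hI₀ : I ⊆ Ioi 0) :
    wnorm q σ a I (fun u => ENNReal.ofReal u * f u) = wnorm q (σ + 1) a I f := by
  refine wnorm_congr hI fun u hu => ?_
  have hu₀ : 0 < u := hI₀ hu
  rw [← mul_assoc, ← ENNReal.ofReal_mul' hu₀.le, add_sub_right_comm,
    Real.rpow_add_one hu₀.ne', mul_right_comm]

theorem abs_deriv_rpow_mul_rpow {l κ x : ℝ} (hl : 0 < l) (hκ : 0 < κ) (hx : 0 < x) (σ i : ℝ) :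
    |l * (κ * x ^ (κ - 1))| ^ i * (l * x ^ κ) ^ (σ - i) =
      κ ^ i * l ^ σ * x ^ (σ * κ - i) := by
  have hx_pow : x ^ (σ * κ - i) = x ^ ((κ - 1) * i) * x ^ (κ * (σ - i)) := by
    rw [← Real.rpow_add hx]
    ring_nf
  have hl_pow : l ^ σ = l ^ i * l ^ (σ - i) := by
    rw [← Real.rpow_add hl, add_sub_cancel]
  rw [abs_of_pos (by positivity), Real.mul_rpow hl.le (by positivity),
    Real.mul_rpow hκ.le (by positivity), Real.mul_rpow hl.le (by positivity),
    ← Real.rpow_mul hx.le, ← Real.rpow_mul hx.le, hx_pow, hl_pow]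
  ring

theorem wnorm_image {l κ : ℝ} (hl : 0 < l) (hκ : 0 < κ) (hI : MeasurableSet I)
    (hI₀ : I ⊆ Ioi 0) :
    wnorm q σ b ((fun x => l * x ^ κ) '' I) g = ENNReal.ofReal (κ ^ (q⁻¹).toReal * l ^ σ) *
      wnorm q (σ * κ) (fun x => b (l * x ^ κ)) I (fun x => g (l * x ^ κ)) := by
  have h_deriv (x : ℝ) (hx : x ∈ I) :
      HasDerivAt (fun x => l * x ^ κ) (l * (κ * x ^ (κ - 1))) x :=
    (Real.hasDerivAt_rpow_const (Or.inl (hI₀ hx).ne')).const_mul l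
  have h_inj : InjOn (fun x => l * x ^ κ) I := fun x hx y hy hxy =>
    (Real.rpow_left_inj (le_of_lt (hI₀ hx)) (le_of_lt (hI₀ hy)) hκ.ne').1
      (mul_left_cancel₀ hl.ne' hxy)
  have h_ne (x : ℝ) (hx : x ∈ I) : l * (κ * x ^ (κ - 1)) ≠ 0 := by
    have := Real.rpow_pos_of_pos (hI₀ hx) (κ - 1)
    positivity
  rw [wnorm, eLpNorm_restrict_image volume hI
    (fun x hx => (h_deriv x hx).hasDerivWithinAt.hasFDerivWithinAt) h_inj
    (by simpa using h_ne), wnorm, ← eLpNorm_ennreal_const_mul ENNReal.ofReal_ne_top]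
  refine eLpNorm_congr_enorm_ae ?_
  filter_upwards [ae_restrict_mem hI] with x hx
  have hx₀ : 0 < x := hI₀ hx
  rw [ContinuousLinearMap.det_toSpanSingleton, ENNReal.ofReal_rpow_of_nonneg (abs_nonneg _)
    ENNReal.toReal_nonneg, ← mul_assoc (ENNReal.ofReal _), ← mul_assoc (ENNReal.ofReal _),
    ← ENNReal.ofReal_mul (by positivity), ← ENNReal.ofReal_mul (by positivity),
    ← mul_assoc (_ ^ _), ← mul_assoc (_ * _), abs_deriv_rpow_mul_rpow hl hκ hx₀]

theorem wnorm_comp_rpow {κ : ℝ} (hκ : 0 < κ) (hI : MeasurableSet I) (hI₀ : I ⊆ Ioi 0) :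
    wnorm q σ (fun t => b (t ^ (1 / κ))) ((fun x => x ^ κ) '' I) g =
      ENNReal.ofReal (κ ^ (q⁻¹).toReal) * wnorm q (σ * κ) b I (fun x => g (x ^ κ)) := by
  have h := wnorm_image (q := q) (σ := σ) (b := fun t => b (t ^ (1 / κ))) (g := g) one_pos hκ
    hI hI₀
  simp only [one_mul, Real.one_rpow, mul_one] at h
  rw [h]
  congr 1
  refine wnorm_congr hI fun x hx => ?_
  rw [← Real.rpow_mul (hI₀ hx).le, mul_one_div_cancel hκ.ne', Real.rpow_one]

theorem image_rpow_const_Ioo {κ u t : ℝ} (hκ : 0 < κ) (hu : 0 ≤ u) (ht : 0 ≤ t) :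
    (fun x : ℝ => x ^ κ) '' Ioo u t = Ioo (u ^ κ) (t ^ κ) := by
  ext y
  constructor
  · rintro ⟨x, hx, rfl⟩
    exact ⟨Real.rpow_lt_rpow hu hx.1 hκ, Real.rpow_lt_rpow (hu.trans hx.1.le) hx.2 hκ⟩
  · intro hy
    have hy₀ : 0 ≤ y := (Real.rpow_nonneg hu κ).trans hy.1.le
    exact ⟨y ^ κ⁻¹, ⟨(Real.lt_rpow_inv_iff_of_pos hu hy₀ hκ).2 hy.1,
      (Real.rpow_inv_lt_iff_of_pos hy₀ ht hκ).2 hy.2⟩, Real.rpow_inv_rpow hy₀ hκ.ne'⟩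

theorem image_rpow_const_Ioi {κ : ℝ} (hκ : κ ≠ 0) :
    (fun x : ℝ => x ^ κ) '' Ioi 0 = Ioi 0 := by
  refine Subset.antisymm (image_subset_iff.2 fun x hx => Real.rpow_pos_of_pos hx κ) ?_
  intro y (hy : 0 < y)
  exact ⟨y ^ κ⁻¹, Real.rpow_pos_of_pos hy _, Real.rpow_inv_rpow hy.le hκ⟩

end WNorm

section UpperType

/-- Weights on `(0,∞)` of upper type `α`: dilating the argument by `s ≥ 1` costs at most a constant
times `s ^ α`. A slowly varying function has upper type `ε` for every `ε > 0`, and this is what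
bounds the dilations of weighted norms. The values of `b` outside `(0,∞)` play no role. -/
structure UpperType (α : ℝ) (b : ℝ → ℝ) : Prop where
  pos : ∀ t, 0 < t → 0 < b t
  aemeasurable : AEMeasurable b (volume.restrict (Ioi 0))
  exists_le : ∃ C : ℝ, ∀ s t, 1 ≤ s → 0 < t → b (s * t) ≤ C * s ^ α * b t

theorem SlowlyVarying.upperType {b : ℝ → ℝ} (hb : SlowlyVarying b) {ε : ℝ} (hε : 0 < ε) :
    UpperType ε b where
  pos := hb.pos
  aemeasurable := hb.measurable
  exists_le := by
    obtain ⟨g, hg, C, hC, hbg⟩ := hb.equiv_decreasing ε hε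
    refine ⟨C * C, fun s t hs ht => ?_⟩
    have hs₀ : 0 < s := one_pos.trans_le hs
    have hst : 0 < s * t := by positivity
    have h_le : (s * t) ^ (-ε) * b (s * t) ≤ C * (C * (t ^ (-ε) * b t)) :=
      calc (s * t) ^ (-ε) * b (s * t) ≤ C * g (s * t) := (hbg _ hst).1
        _ ≤ C * g t := by
          gcongr
          exact hg ht hst (le_mul_of_one_le_left ht.le hs)
        _ ≤ C * (C * (t ^ (-ε) * b t)) := by
          gcongr
          exact (hbg t ht).2
    calc b (s * t) = (s * t) ^ ε * ((s * t) ^ (-ε) * b (s * t)) := by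
          rw [← mul_assoc, ← Real.rpow_add hst, add_neg_cancel, Real.rpow_zero, one_mul]
      _ ≤ (s * t) ^ ε * (C * (C * (t ^ (-ε) * b t))) := by gcongr
      _ = C * C * s ^ ε * b t := by
          rw [Real.mul_rpow hs₀.le ht.le, Real.rpow_neg ht.le]
          field_simp

/-- The supremum of the dyadic dilates `h (t / 2 ^ j)`, weighted by `2 ^ (j * ε)`. -/
noncomputable def dyadicSup (ε : ℝ) (h : ℝ → ℝ≥0∞) (t : ℝ) : ℝ≥0∞ :=
  ⨆ j : ℕ, 2 ^ (j * ε) * h (t / 2 ^ j)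

variable {α ε γ σ : ℝ} {b : ℝ → ℝ}

theorem UpperType.exists_wnorm_dilation_le (hb : UpperType α b) (q : ℝ≥0∞) (σ : ℝ) :
    ∃ C : ℝ≥0, ∀ (h : ℝ → ℝ≥0∞) (l u t : ℝ), 1 ≤ l → 0 ≤ u →
      wnorm q σ b (Ioo u t) (fun v => h (v / l)) ≤
        C * ENNReal.ofReal l ^ (α + σ) * wnorm q σ b (Ioo (u / l) (t / l)) h := by
  obtain ⟨C, hC⟩ := hb.exists_le
  refine ⟨C.toNNReal, fun h l u t hl hu => ?_⟩
  have hl₀ : 0 < l := one_pos.trans_le hl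
  have hI₀ : Ioo (u / l) (t / l) ⊆ Ioi 0 := fun x hx => (by positivity : 0 ≤ u / l).trans_lt hx.1
  have h_image : (fun x : ℝ => l * x ^ (1 : ℝ)) '' Ioo (u / l) (t / l) = Ioo u t := by
    simp only [Real.rpow_one, image_mul_left_Ioo hl₀, mul_div_cancel₀ _ hl₀.ne']
  have h_weight : wnorm q σ (fun x => b (l * x)) (Ioo (u / l) (t / l)) h ≤
      ENNReal.ofReal (C * l ^ α) * wnorm q σ b (Ioo (u / l) (t / l)) h := by
    rw [← wnorm_const_mul ENNReal.ofReal_ne_top]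
    refine wnorm_mono measurableSet_Ioo fun v hv => ?_
    have hv₀ : 0 < v := hI₀ hv
    rw [← mul_assoc, ← ENNReal.ofReal_mul (mul_nonneg (by positivity) (hb.pos v hv₀).le),
      mul_assoc, mul_comm (b v)]
    gcongr
    exact hC l v hl hv₀
  rw [← h_image, wnorm_image hl₀ one_pos measurableSet_Ioo hI₀]
  simp only [Real.one_rpow, one_mul, mul_one, Real.rpow_one, mul_div_cancel_left₀ _ hl₀.ne']
  calc _ ≤ ENNReal.ofReal (l ^ σ) *
        (ENNReal.ofReal (C * l ^ α) * wnorm q σ b (Ioo (u / l) (t / l)) h) := by gcongr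
    _ = _ := by
      rw [ENNReal.ofReal_rpow_of_pos hl₀, Real.rpow_add hl₀, ← mul_assoc,
        ← ENNReal.ofReal_mul (by positivity), mul_left_comm, mul_comm (l ^ σ),
        ENNReal.ofReal_mul' (by positivity)]
      rfl

theorem UpperType.exists_wnorm_dyadicSup_le (hb : UpperType α b) (q : ℝ≥0∞)
    (hγ : ε + α + σ < γ) :
    ∃ C : ℝ≥0, ∀ h : ℝ → ℝ≥0∞, Measurable h → ∀ u t : ℝ, 0 ≤ u →
      wnorm q σ b (Ioo u t) (dyadicSup ε h) ≤
        C * ⨆ j : ℕ, 2 ^ (j * γ) * wnorm q σ b (Ioo (u / 2 ^ j) (t / 2 ^ j)) h := by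
  obtain ⟨C₁, hC₁⟩ := exists_eLpNorm_iSup_le (α := ℝ) q (sub_pos.2 hγ)
  obtain ⟨C₂, hC₂⟩ := hb.exists_wnorm_dilation_le q σ
  refine ⟨C₁ * C₂, fun h hh u t hu => ?_⟩
  have hbI : AEMeasurable b (volume.restrict (Ioo u t)) :=
    hb.aemeasurable.mono_measure (Measure.restrict_mono (fun v hv => hu.trans_lt hv.1) le_rfl)
  have h_sup : wnorm q σ b (Ioo u t) (dyadicSup ε h) ≤ C₁ * ⨆ j : ℕ, 2 ^ (j * (γ - (ε + α + σ))) *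
      wnorm q σ b (Ioo u t) (fun v => 2 ^ (j * ε) * h (v / 2 ^ j)) := by
    simpa only [wnorm, dyadicSup, ENNReal.mul_iSup] using hC₁ (volume.restrict (Ioo u t))
      (fun j v => ENNReal.ofReal (v ^ (σ - (q⁻¹).toReal) * b v) * (2 ^ (j * ε) * h (v / 2 ^ j)))
      fun j => ((measurable_id.pow_const _).aemeasurable.mul hbI).ennreal_ofReal.mul
        ((hh.comp (measurable_id.div_const _)).const_mul _).aemeasurable
  refine h_sup.trans ?_
  rw [ENNReal.coe_mul, mul_assoc, ENNReal.mul_iSup (a := (C₂ : ℝ≥0∞))]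
  refine mul_le_mul_right (iSup_mono fun j => ?_) _
  rw [wnorm_const_mul (by finiteness)]
  calc _ ≤ 2 ^ (j * (γ - (ε + α + σ))) * (2 ^ (j * ε) * (C₂ * ENNReal.ofReal (2 ^ j) ^ (α + σ) *
        wnorm q σ b (Ioo (u / 2 ^ j) (t / 2 ^ j)) h)) := by
        gcongr
        exact hC₂ h _ u t (one_le_pow₀ one_le_two) hu
    _ = C₂ * (2 ^ (j * (γ - (ε + α + σ))) * 2 ^ (j * ε) * 2 ^ (j * (α + σ)) *
          wnorm q σ b (Ioo (u / 2 ^ j) (t / 2 ^ j)) h) := by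
        rw [ENNReal.ofReal_pow zero_le_two, ENNReal.ofReal_ofNat, ← ENNReal.rpow_natCast,
          ← ENNReal.rpow_mul]
        ring
    _ = _ := by
        rw [← ENNReal.rpow_add _ _ two_ne_zero ENNReal.ofNat_ne_top,
          ← ENNReal.rpow_add _ _ two_ne_zero ENNReal.ofNat_ne_top]
        ring_nf

end UpperType

section NormRL

variable {α β ε σ : ℝ} {a b c : ℝ → ℝ} {q r s : ℝ≥0∞} {g h : ℝ → ℝ≥0∞}

theorem normRL_mono (hgh : ∀ t, 0 < t → g t ≤ h t) :
    normRL σ s c r b q a g ≤ normRL σ s c r b q a h :=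
  wnorm_mono_fun measurableSet_Ioi fun _ _ => wnorm_mono_fun measurableSet_Ioo fun _ hu =>
    wnorm_mono_fun measurableSet_Ioo fun _ hv => hgh _ (hu.1.trans hv.1)

theorem normRL_const_mul {K : ℝ≥0∞} (hK : K ≠ ∞) :
    normRL σ s c r b q a (fun t => K * g t) = K * normRL σ s c r b q a g := by
  simp only [normRL, wnorm_const_mul hK]

theorem normRL_top (hq : q ≠ 0) (hr : r ≠ 0) (hs : s ≠ 0) (ha : ∀ t, 0 < t → 0 < a t)
    (hb : ∀ t, 0 < t → 0 < b t) (hc : ∀ t, 0 < t → 0 < c t) :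
    normRL σ s c r b q a (fun _ => ∞) = ∞ := by
  have h_inner (t u : ℝ) (hu : u ∈ Ioo 0 t) : wnorm q σ a (Ioo u t) (fun _ => ∞) = ∞ :=
    wnorm_top hq (fun v hv => ha v (hu.1.trans hv.1)) measurableSet_Ioo
      (fun v hv => hu.1.trans hv.1) (by simpa using hu.2)
  have h_middle (t : ℝ) (ht : 0 < t) :
      wnorm r 0 b (Ioo 0 t) (fun u => wnorm q σ a (Ioo u t) fun _ => ∞) = ∞ := by
    rw [wnorm_congr_fun measurableSet_Ioo (h_inner t)]
    exact wnorm_top hr (fun u hu => hb u hu.1) measurableSet_Ioo Ioo_subset_Ioi_self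
      (by simpa using ht)
  rw [normRL, wnorm_congr_fun measurableSet_Ioi h_middle]
  exact wnorm_top hs hc measurableSet_Ioi subset_rfl (by simp)

theorem normRL_ofReal_mul :
    normRL σ s c r b q a (fun t => ENNReal.ofReal t * g t) = normRL (σ + 1) s c r b q a g :=
  wnorm_congr_fun measurableSet_Ioi fun _ _ => wnorm_congr_fun measurableSet_Ioo fun _ hu =>
    wnorm_ofReal_mul measurableSet_Ioo fun _ hv => hu.1.trans hv.1

theorem normRL_comp_rpow {κ : ℝ} (hκ : 0 < κ) :
    normRL σ s (fun t => c (t ^ (1 / κ))) r (fun t => b (t ^ (1 / κ))) q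
        (fun t => a (t ^ (1 / κ))) g =
      ENNReal.ofReal (κ ^ ((s⁻¹).toReal + (r⁻¹).toReal + (q⁻¹).toReal)) *
        normRL (σ * κ) s c r b q a fun w => g (w ^ κ) := by
  have h_inner (t u : ℝ) (hu : u ∈ Ioo 0 t) :
      wnorm q σ (fun t => a (t ^ (1 / κ))) (Ioo (u ^ κ) (t ^ κ)) g =
        ENNReal.ofReal (κ ^ (q⁻¹).toReal) *
          wnorm q (σ * κ) a (Ioo u t) fun w => g (w ^ κ) := by
    rw [← image_rpow_const_Ioo hκ hu.1.le (hu.1.trans hu.2).le]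
    exact wnorm_comp_rpow hκ measurableSet_Ioo fun v hv => hu.1.trans hv.1
  have h_middle (t : ℝ) (ht : 0 < t) :
      wnorm r 0 (fun t => b (t ^ (1 / κ))) (Ioo 0 (t ^ κ)) (fun u =>
        wnorm q σ (fun t => a (t ^ (1 / κ))) (Ioo u (t ^ κ)) g) =
      ENNReal.ofReal (κ ^ (r⁻¹).toReal) * (ENNReal.ofReal (κ ^ (q⁻¹).toReal) *
        wnorm r 0 b (Ioo 0 t) fun u => wnorm q (σ * κ) a (Ioo u t) fun w => g (w ^ κ)) := by
    have h_image : (fun x : ℝ => x ^ κ) '' Ioo 0 t = Ioo 0 (t ^ κ) := by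
      rw [image_rpow_const_Ioo hκ le_rfl ht.le, Real.zero_rpow hκ.ne']
    rw [← h_image, wnorm_comp_rpow hκ measurableSet_Ioo Ioo_subset_Ioi_self, zero_mul,
      wnorm_congr_fun measurableSet_Ioo (h_inner t), wnorm_const_mul ENNReal.ofReal_ne_top]
  have h_outer := wnorm_comp_rpow (q := s) (σ := 0) (b := c) (g := fun t =>
    wnorm r 0 (fun t => b (t ^ (1 / κ))) (Ioo 0 t) fun u =>
      wnorm q σ (fun t => a (t ^ (1 / κ))) (Ioo u t) g) hκ measurableSet_Ioi subset_rfl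
  rw [image_rpow_const_Ioi hκ.ne', zero_mul, wnorm_congr_fun measurableSet_Ioi h_middle,
    wnorm_const_mul ENNReal.ofReal_ne_top, wnorm_const_mul ENNReal.ofReal_ne_top] at h_outer
  rw [Real.rpow_add hκ, Real.rpow_add hκ, ENNReal.ofReal_mul (by positivity),
    ENNReal.ofReal_mul (by positivity), mul_assoc, mul_assoc]
  exact h_outer

theorem exists_normRL_dyadicSup_le (ha : UpperType α a) (hb : UpperType β b)
    (hε : ε + α + σ + β < 0) :
    ∃ C : ℝ≥0, ∀ h : ℝ → ℝ≥0∞, Measurable h →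
      normRL σ s c r b q a (dyadicSup ε h) ≤ C * normRL σ s c r b q a h := by
  obtain ⟨γ, hγ₁, hγ₂⟩ := exists_between (show ε + α + σ < -β by linarith)
  obtain ⟨C₁, hC₁⟩ := ha.exists_wnorm_dyadicSup_le q hγ₁
  obtain ⟨C₂, hC₂⟩ := hb.exists_wnorm_dyadicSup_le r (ε := γ) (σ := 0) (γ := 0) (by linarith)
  refine ⟨C₁ * C₂, fun h hh => wnorm_le_const_mul measurableSet_Ioi ENNReal.coe_ne_top
    fun t (ht : 0 < t) => ?_⟩
  have h_div (x : ℝ) (hx : 0 ≤ x) (j : ℕ) : x / 2 ^ j ≤ x :=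
    div_le_self hx (one_le_pow₀ one_le_two)
  set H : ℝ → ℝ≥0∞ := fun u => wnorm q σ a (Ioo u t) h
  have hH : Measurable H := Antitone.measurable fun u v huv =>
    wnorm_mono_set (Ioo_subset_Ioo_left huv)
  have h_inner (u : ℝ) (hu : u ∈ Ioo 0 t) :
      wnorm q σ a (Ioo u t) (dyadicSup ε h) ≤ C₁ * dyadicSup γ H u := by
    refine (hC₁ h hh u t hu.1.le).trans ?_
    unfold dyadicSup
    gcongr with j
    exact wnorm_mono_set (Ioo_subset_Ioo_right (h_div t ht.le j))
  have h_outer : wnorm r 0 b (Ioo 0 t) (dyadicSup γ H) ≤ C₂ * wnorm r 0 b (Ioo 0 t) H := by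
    refine (hC₂ H hH 0 t le_rfl).trans ?_
    gcongr
    refine iSup_le fun j => ?_
    rw [mul_zero, ENNReal.rpow_zero, one_mul, zero_div]
    exact wnorm_mono_set (Ioo_subset_Ioo_right (h_div t ht.le j))
  calc _ ≤ C₁ * wnorm r 0 b (Ioo 0 t) (dyadicSup γ H) :=
        wnorm_le_const_mul measurableSet_Ioo ENNReal.coe_ne_top h_inner
    _ ≤ C₁ * (C₂ * wnorm r 0 b (Ioo 0 t) H) := by gcongr
    _ = _ := by rw [ENNReal.coe_mul, mul_assoc]

end NormRL

section Rearrangement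

variable {Ω : Type*} [MeasurableSpace Ω] {μ : Measure Ω} {𝕜 : Type*} [RCLike 𝕜]
  {κ ε t : ℝ}

theorem measurableSet_lt_enorm (f : Ω →ₘ[μ] 𝕜) (L : ℝ≥0∞) :
    MeasurableSet {x | L < ‖f x‖ₑ} :=
  measurableSet_lt measurable_const f.stronglyMeasurable.measurable.enorm

theorem rearr_antitone (f : Ω →ₘ[μ] 𝕜) : Antitone (rearr f) := fun _ _ h =>
  sInf_le_sInf fun _ hl => le_trans hl (ENNReal.ofReal_le_ofReal h)

theorem measure_rearr_lt_le (f : Ω →ₘ[μ] 𝕜) (t : ℝ) :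
    μ {x | rearr f t < ‖f x‖ₑ} ≤ ENNReal.ofReal t := by
  rcases eq_or_ne (rearr f t) ∞ with h_top | h_top
  · simp [h_top]
  obtain ⟨u, hu, h_lt, h_lim⟩ := exists_seq_strictAnti_tendsto' (lt_top_iff_ne_top.2 h_top)
  have h_iUnion : {x | rearr f t < ‖f x‖ₑ} = ⋃ n, {x | u n < ‖f x‖ₑ} := by
    ext x
    simp only [mem_ofPred_eq, mem_iUnion]
    exact ⟨fun hx => (h_lim.eventually_lt_const hx).exists, fun ⟨n, hn⟩ => (h_lt n).1.trans hn⟩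
  have h_mono : Monotone fun n => {x | u n < ‖f x‖ₑ} := fun m n hmn x hx =>
    (hu.antitone hmn).trans_lt hx
  rw [h_iUnion, h_mono.measure_iUnion]
  refine iSup_le fun n => ?_
  obtain ⟨l, hl, hln⟩ := sInf_lt_iff.1 (h_lt n).1
  exact (measure_mono fun x (hx : u n < ‖f x‖ₑ) => hln.trans hx).trans hl

theorem rearr_add_le (f g : Ω →ₘ[μ] 𝕜) (t : ℝ) :
    rearr (f + g) t ≤ rearr f t + eLpNorm g ∞ μ := by
  refine sInf_le (le_trans (measure_mono_ae ?_) (measure_rearr_lt_le f t))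
  rw [eLpNorm_exponent_top]
  filter_upwards [AEEqFun.coeFn_add f g, ae_le_eLpNormEssSup (f := g) (μ := μ)]
    with x h_add hg (h : _ < _)
  rw [h_add, Pi.add_apply] at h
  by_contra hf
  exact h.not_ge ((enorm_add_le _ _).trans (add_le_add (not_lt.1 hf) hg))

theorem ofReal_rpow_mul_rearr_le (hκ : 0 < κ) (f : Ω →ₘ[μ] 𝕜) (ht : 0 < t) :
    ENNReal.ofReal (t ^ (1 / κ)) * rearr f t ≤ eLpNorm f (ENNReal.ofReal κ) μ := by
  have ht_pos : 0 < ENNReal.ofReal (t ^ (1 / κ)) :=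
    ENNReal.ofReal_pos.2 (Real.rpow_pos_of_pos ht _)
  rw [mul_comm, ← ENNReal.le_div_iff_mul_le (Or.inl ht_pos.ne') (Or.inl ENNReal.ofReal_ne_top)]
  refine le_of_forall_lt_imp_le_of_dense fun l hl => ?_
  have h_meas : ENNReal.ofReal t ≤ μ {x | l < ‖f x‖ₑ} :=
    (not_le.1 fun h => (sInf_le h : rearr f t ≤ l).not_gt hl).le
  rw [ENNReal.le_div_iff_mul_le (Or.inl ht_pos.ne') (Or.inl ENNReal.ofReal_ne_top),
    ← ENNReal.rpow_le_rpow_iff hκ]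
  calc (l * ENNReal.ofReal (t ^ (1 / κ))) ^ κ = l ^ κ * ENNReal.ofReal t := by
        rw [ENNReal.mul_rpow_of_nonneg _ _ hκ.le, ENNReal.ofReal_rpow_of_nonneg (by positivity)
          hκ.le, ← Real.rpow_mul ht.le, one_div_mul_cancel hκ.ne', Real.rpow_one]
    _ ≤ l ^ κ * μ {x | l ≤ ‖f x‖ₑ} := by
        gcongr
        exact h_meas.trans (measure_mono fun x (hx : l < _) => hx.le)
    _ ≤ eLpNorm f (ENNReal.ofReal κ) μ ^ κ := by
        simpa only [ENNReal.toReal_ofReal hκ.le] using mul_meas_ge_le_pow_eLpNorm' μ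
          (ENNReal.ofReal_pos.2 hκ).ne' ENNReal.ofReal_ne_top f.aestronglyMeasurable l

/-- The function `t ↦ t f*(t ^ κ)`, the model of the `K`-functionals of `(L_κ, L_∞)` and
`(L_{κ,∞}, L_∞)`. -/
noncomputable def powRearr (κ : ℝ) (f : Ω →ₘ[μ] 𝕜) (t : ℝ) : ℝ≥0∞ :=
  ENNReal.ofReal t * rearr f (t ^ κ)

theorem measurable_powRearr (κ : ℝ) (f : Ω →ₘ[μ] 𝕜) : Measurable (powRearr κ f) :=
  ENNReal.measurable_ofReal.mul
    ((rearr_antitone f).measurable.comp (measurable_id.pow_const κ))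

theorem powRearr_le_peetreK (hκ : 0 < κ) (f : Ω →ₘ[μ] 𝕜) (ht : 0 < t) :
    powRearr κ f t ≤ peetreK (WeakLeb 𝕜 μ κ) (Leb 𝕜 μ ∞) f t := by
  refine le_iInf₂ fun f₀ _ => le_iInf₂ fun f₁ _ => le_iInf fun hf => ?_
  have h_weak : powRearr κ f₀ t ≤ (WeakLeb 𝕜 μ κ).qnorm f₀ := by
    refine le_of_eq_of_le ?_ (le_iSup₂_of_le (t ^ κ) (Real.rpow_pos_of_pos ht κ) le_rfl)
    rw [powRearr, ← Real.rpow_mul ht.le, mul_one_div_cancel hκ.ne', Real.rpow_one]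
  calc powRearr κ f t ≤ ENNReal.ofReal t * (rearr f₀ (t ^ κ) + eLpNorm f₁ ∞ μ) := by
        rw [hf]
        exact mul_le_mul_right (rearr_add_le f₀ f₁ _) _
    _ = powRearr κ f₀ t + ENNReal.ofReal t * eLpNorm f₁ ∞ μ := mul_add _ _ _
    _ ≤ _ := add_le_add_left h_weak _

theorem weakLeb_qnorm_le (hκ : 0 < κ) (f : Ω →ₘ[μ] 𝕜) :
    (WeakLeb 𝕜 μ κ).qnorm f ≤ (Leb 𝕜 μ (ENNReal.ofReal κ)).qnorm f :=
  iSup₂_le fun _ ht => ofReal_rpow_mul_rearr_le hκ f ht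

theorem peetreK_weakLeb_le (hκ : 0 < κ) (f : Ω →ₘ[μ] 𝕜) (t : ℝ) :
    peetreK (WeakLeb 𝕜 μ κ) (Leb 𝕜 μ ∞) f t ≤
      peetreK (Leb 𝕜 μ (ENNReal.ofReal κ)) (Leb 𝕜 μ ∞) f t := by
  refine le_iInf₂ fun f₀ h₀ => le_iInf₂ fun f₁ h₁ => le_iInf fun hf => ?_
  have h₀_weak : f₀ ∈ (WeakLeb 𝕜 μ κ).carrier := (weakLeb_qnorm_le hκ f₀).trans_lt h₀
  refine (iInf₂_le f₀ h₀_weak).trans <| (iInf₂_le f₁ h₁).trans <| (iInf_le _ hf).trans ?_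
  gcongr
  exact weakLeb_qnorm_le hκ f₀

theorem ae_exists_enorm_le_rearr (f : Ω →ₘ[μ] 𝕜) {s : ℕ → ℝ}
    (hs : Filter.Tendsto s Filter.atTop (nhds 0)) :
    ∀ᵐ x ∂μ, ∃ j, ‖f x‖ₑ ≤ rearr f (s j) := by
  have h_null : μ (⋂ j, {x | rearr f (s j) < ‖f x‖ₑ}) ≤ 0 := by
    refine ge_of_tendsto' (ENNReal.ofReal_zero ▸ ENNReal.tendsto_ofReal hs) fun j => ?_
    exact (measure_mono (iInter_subset _ j)).trans (measure_rearr_lt_le f (s j))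
  filter_upwards [measure_eq_zero_iff_ae_notMem.1 (nonpos_iff_eq_zero.1 h_null)] with x hx
  simpa using hx

theorem lintegral_indicator_rearr_lt_le (hκ : 0 < κ) (f : Ω →ₘ[μ] 𝕜) {s : ℕ → ℝ}
    (hs : Filter.Tendsto s Filter.atTop (nhds 0)) :
    ∫⁻ x, ‖{x | rearr f (s 0) < ‖f x‖ₑ}.indicator f x‖ₑ ^ κ ∂μ ≤
      ∑' j, rearr f (s (j + 1)) ^ κ * ENNReal.ofReal (s j) := by
  set E : ℕ → Set Ω := fun j => {x | rearr f (s j) < ‖f x‖ₑ}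
  have h_layer : ∀ᵐ x ∂μ, ‖(E 0).indicator f x‖ₑ ^ κ ≤
      ∑' j, (E j).indicator (fun _ => rearr f (s (j + 1)) ^ κ) x := by
    filter_upwards [ae_exists_enorm_le_rearr f hs] with x hx
    by_cases hx₀ : x ∈ E 0
    · obtain ⟨m, hm, hm_succ⟩ : ∃ m, x ∈ E m ∧ ‖f x‖ₑ ≤ rearr f (s (m + 1)) := by
        by_contra! h
        obtain ⟨j, hj⟩ := hx
        exact hj.not_gt (j.rec hx₀ h)
      refine le_trans ?_ (ENNReal.le_tsum m)
      rw [indicator_of_mem hx₀, indicator_of_mem hm]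
      gcongr
    · simp [hx₀, hκ]
  calc ∫⁻ x, ‖(E 0).indicator f x‖ₑ ^ κ ∂μ
      ≤ ∫⁻ x, ∑' j, (E j).indicator (fun _ => rearr f (s (j + 1)) ^ κ) x ∂μ :=
        lintegral_mono_ae h_layer
    _ = ∑' j, rearr f (s (j + 1)) ^ κ * μ (E j) := by
        rw [lintegral_tsum fun j =>
          (measurable_const.indicator (measurableSet_lt_enorm f _)).aemeasurable]
        simp only [lintegral_indicator_const (measurableSet_lt_enorm f _), E]
    _ ≤ ∑' j, rearr f (s (j + 1)) ^ κ * ENNReal.ofReal (s j) := by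
        gcongr with j
        exact measure_rearr_lt_le f (s j)

theorem exists_truncation (f : Ω →ₘ[μ] 𝕜) (L : ℝ≥0∞) :
    ∃ f₀ f₁ : Ω →ₘ[μ] 𝕜, f = f₀ + f₁ ∧ f₀ =ᵐ[μ] {x | L < ‖f x‖ₑ}.indicator f ∧
      eLpNorm f₁ ∞ μ ≤ L := by
  set E : Set Ω := {x | L < ‖f x‖ₑ}
  have hE : MeasurableSet E := measurableSet_lt_enorm f L
  set f₀ := AEEqFun.mk (E.indicator f) (f.aestronglyMeasurable.indicator hE)
  have hf₀ : f₀ =ᵐ[μ] E.indicator f := AEEqFun.coeFn_mk _ _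
  refine ⟨f₀, f - f₀, (add_sub_cancel _ _).symm, hf₀, ?_⟩
  rw [eLpNorm_exponent_top, eLpNormEssSup_eq_essSup_enorm]
  refine essSup_le_of_ae_le _ ?_
  filter_upwards [AEEqFun.coeFn_sub f f₀, hf₀] with x h_sub hx
  rw [h_sub, Pi.sub_apply, hx]
  by_cases hxE : x ∈ E
  · simp [hxE]
  · simpa [hxE] using not_lt.1 hxE

theorem eLpNorm_indicator_rearr_lt_le (hκ : 0 < κ) (f : Ω →ₘ[μ] 𝕜) (ht : 0 < t) :
    eLpNorm ({x | rearr f (t ^ κ) < ‖f x‖ₑ}.indicator f) (ENNReal.ofReal κ) μ ≤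
      (∑' j : ℕ, (2 * powRearr κ f (t / 2 ^ (j + 1))) ^ κ) ^ (1 / κ) := by
  have h_lim : Filter.Tendsto (fun j : ℕ => (t / 2 ^ j) ^ κ) Filter.atTop (nhds 0) := by
    have h_pow : Filter.Tendsto (fun j : ℕ => t / 2 ^ j) Filter.atTop (nhds 0) :=
      tendsto_const_nhds.div_atTop (tendsto_pow_atTop_atTop_of_one_lt one_lt_two)
    simpa [Real.zero_rpow hκ.ne'] using h_pow.rpow_const (p := κ) (Or.inr hκ.le)
  have h_term (j : ℕ) : rearr f ((t / 2 ^ (j + 1)) ^ κ) ^ κ * ENNReal.ofReal ((t / 2 ^ j) ^ κ) =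
      (2 * powRearr κ f (t / 2 ^ (j + 1))) ^ κ := by
    have h_two : ENNReal.ofReal (t / 2 ^ j) = 2 * ENNReal.ofReal (t / 2 ^ (j + 1)) := by
      rw [← ENNReal.ofReal_ofNat 2, ← ENNReal.ofReal_mul zero_le_two]
      congr 1
      ring
    rw [← ENNReal.ofReal_rpow_of_pos (by positivity), ← ENNReal.mul_rpow_of_nonneg _ _ hκ.le,
      h_two, powRearr, mul_comm, mul_assoc]
  rw [eLpNorm_eq_lintegral_rpow_enorm_toReal (ENNReal.ofReal_pos.2 hκ).ne' ENNReal.ofReal_ne_top,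
    ENNReal.toReal_ofReal hκ.le]
  gcongr
  simpa [h_term] using lintegral_indicator_rearr_lt_le hκ f h_lim

theorem peetreK_leb_le (hκ : 0 < κ) (f : Ω →ₘ[μ] 𝕜) (ht : 0 < t) :
    peetreK (Leb 𝕜 μ (ENNReal.ofReal κ)) (Leb 𝕜 μ ∞) f t ≤
      (∑' j : ℕ, (2 * powRearr κ f (t / 2 ^ (j + 1))) ^ κ) ^ (1 / κ) + powRearr κ f t := by
  rcases eq_or_ne (powRearr κ f t) ∞ with h_top | h_top
  · simp [h_top]
  set N := (∑' j : ℕ, (2 * powRearr κ f (t / 2 ^ (j + 1))) ^ κ) ^ (1 / κ)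
  rcases eq_or_ne N ∞ with hN | hN
  · simp [hN]
  obtain ⟨f₀, f₁, hf, hf₀, hf₁⟩ := exists_truncation f (rearr f (t ^ κ))
  have h₀ : eLpNorm f₀ (ENNReal.ofReal κ) μ ≤ N :=
    (eLpNorm_congr_ae hf₀).trans_le (eLpNorm_indicator_rearr_lt_le hκ f ht)
  have h₁ : ENNReal.ofReal t * eLpNorm f₁ ∞ μ ≤ powRearr κ f t := mul_le_mul_right hf₁ _
  have hf₀_mem : f₀ ∈ (Leb 𝕜 μ (ENNReal.ofReal κ)).carrier := h₀.trans_lt hN.lt_top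
  have hf₁_mem : f₁ ∈ (Leb 𝕜 μ ∞).carrier :=
    ENNReal.lt_top_of_mul_ne_top_right (h₁.trans_lt h_top.lt_top).ne (ENNReal.ofReal_pos.2 ht).ne'
  exact (iInf₂_le f₀ hf₀_mem).trans <| (iInf₂_le f₁ hf₁_mem).trans <| (iInf_le _ hf).trans <|
    add_le_add h₀ h₁

theorem exists_peetreK_leb_le (hκ : 0 < κ) (hε : 0 < ε) :
    ∃ C : ℝ≥0, ∀ (f : Ω →ₘ[μ] 𝕜) (t : ℝ), 0 < t →
      peetreK (Leb 𝕜 μ (ENNReal.ofReal κ)) (Leb 𝕜 μ ∞) f t ≤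
        C * dyadicSup ε (powRearr κ f) t := by
  obtain ⟨C, hC⟩ := exists_tsum_rpow_le hκ hε
  refine ⟨C * 2 + 1, fun f t ht => (peetreK_leb_le hκ f ht).trans ?_⟩
  have h_le (j : ℕ) : 2 ^ (j * ε) * powRearr κ f (t / 2 ^ j) ≤ dyadicSup ε (powRearr κ f) t :=
    le_iSup (fun j : ℕ => 2 ^ (j * ε) * powRearr κ f (t / 2 ^ j)) j
  have h_succ (j : ℕ) : 2 ^ (j * ε) * (2 * powRearr κ f (t / 2 ^ (j + 1))) ≤
      2 * dyadicSup ε (powRearr κ f) t := by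
    rw [mul_left_comm]
    gcongr
    refine le_trans ?_ (h_le (j + 1))
    gcongr
    · exact one_le_two
    · exact j.le_succ
  calc _ ≤ C * (2 * dyadicSup ε (powRearr κ f) t) + dyadicSup ε (powRearr κ f) t := by
        gcongr
        · exact (hC _).trans (mul_le_mul_right (iSup_le h_succ) _)
        · simpa using h_le 0
    _ = _ := by
        push_cast
        ring

end Rearrangement

section Spaces

variable {Ω : Type*} [MeasurableSpace Ω] {μ : Measure Ω} {𝕜 : Type*} [RCLike 𝕜]
  {a b c : ℝ → ℝ} {q r s : ℝ≥0∞} {θ κ : ℝ}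

theorem FunctionSpace.Embeds.trans {X Y Z : FunctionSpace 𝕜 μ} (hXY : X.Embeds Y)
    (hYZ : Y.Embeds Z) : X.Embeds Z := by
  obtain ⟨h_sub, C, hC, h⟩ := hXY
  obtain ⟨h_sub', C', hC', h'⟩ := hYZ
  refine ⟨h_sub.trans h_sub', C' * C, mul_pos hC' hC, fun f hf => ?_⟩
  rw [ENNReal.ofReal_mul hC'.le, mul_assoc]
  exact (h' f (h_sub hf)).trans (mul_le_mul_right (h f hf) _)

theorem FunctionSpace.ofFinite_embeds_ofFinite {N N' : (Ω →ₘ[μ] 𝕜) → ℝ≥0∞} {C : ℝ≥0}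
    (h : ∀ f, N' f ≤ C * N f) : (ofFinite N).Embeds (ofFinite N') := by
  refine ⟨fun f hf => (h f).trans_lt (ENNReal.mul_lt_top ENNReal.coe_lt_top hf), C + 1,
    by positivity, fun f _ => (h f).trans ?_⟩
  rw [← ENNReal.ofReal_coe_nnreal]
  exact mul_le_mul_left (ENNReal.ofReal_le_ofReal (by linarith)) _

theorem extremalRL_eq_ofFinite (A₀ A₁ : FunctionSpace 𝕜 μ) (hq : q ≠ 0) (hr : r ≠ 0) (hs : s ≠ 0)
    (ha : ∀ t, 0 < t → 0 < a t) (hb : ∀ t, 0 < t → 0 < b t) (hc : ∀ t, 0 < t → 0 < c t) :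
    extremalRL A₀ A₁ θ s c r b q a =
      .ofFinite fun f => normRL (-θ) s c r b q a (peetreK A₀ A₁ f) := by
  unfold extremalRL FunctionSpace.ofFinite
  congr 1
  ext f
  refine and_iff_right_of_imp fun hf => ?_
  by_contra h_sum
  have hK : peetreK A₀ A₁ f = fun _ => ∞ := funext fun t => top_le_iff.1 <|
    le_iInf₂ fun f₀ h₀ => le_iInf₂ fun f₁ h₁ => le_iInf fun h =>
      absurd ⟨f₀, h₀, f₁, h₁, h⟩ h_sum
  rw [hK, normRL_top hq hr hs ha hb hc] at hf
  exact lt_irrefl _ hf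

theorem toReal_inv_ofReal_div_ofReal {x y : ℝ} (hx : 0 < x) (hy : 0 ≤ y) :
    ((ENNReal.ofReal x / ENNReal.ofReal y)⁻¹).toReal = y / x := by
  rw [ENNReal.inv_div (Or.inl ENNReal.ofReal_ne_top) (Or.inr (ENNReal.ofReal_pos.2 hx).ne'),
    ENNReal.toReal_div, ENNReal.toReal_ofReal hx.le, ENNReal.toReal_ofReal hy]

theorem normRL_rearr (hκ : 0 < κ) (f : Ω →ₘ[μ] 𝕜) :
    normRL ((1 - θ) / κ) s (fun t => c (t ^ (1 / κ))) r (fun t => b (t ^ (1 / κ))) q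
        (fun t => a (t ^ (1 / κ))) (rearr f) =
      ENNReal.ofReal (κ ^ ((s⁻¹).toReal + (r⁻¹).toReal + (q⁻¹).toReal)) *
        normRL (-θ) s c r b q a (powRearr κ f) := by
  rw [normRL_comp_rpow hκ, div_mul_cancel₀ _ hκ.ne', sub_eq_neg_add, ← normRL_ofReal_mul]
  rfl

theorem extremalRL_leb_embeds_extremalRL_weakLeb (hκ : 0 < κ) (hq : q ≠ 0) (hr : r ≠ 0)
    (hs : s ≠ 0) (ha : ∀ t, 0 < t → 0 < a t) (hb : ∀ t, 0 < t → 0 < b t)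
    (hc : ∀ t, 0 < t → 0 < c t) :
    (extremalRL (Leb 𝕜 μ (ENNReal.ofReal κ)) (Leb 𝕜 μ ∞) θ s c r b q a).Embeds
      (extremalRL (WeakLeb 𝕜 μ κ) (Leb 𝕜 μ ∞) θ s c r b q a) := by
  simp only [extremalRL_eq_ofFinite _ _ hq hr hs ha hb hc]
  refine FunctionSpace.ofFinite_embeds_ofFinite (C := 1) fun f => ?_
  rw [ENNReal.coe_one, one_mul]
  exact normRL_mono fun t _ => peetreK_weakLeb_le hκ f t

theorem extremalRL_weakLeb_embeds_lorentzKaramataRL (hκ : 0 < κ) {p : ℝ≥0∞}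
    (hp : (p⁻¹).toReal = (1 - θ) / κ) (hq : q ≠ 0) (hr : r ≠ 0) (hs : s ≠ 0)
    (ha : ∀ t, 0 < t → 0 < a t) (hb : ∀ t, 0 < t → 0 < b t) (hc : ∀ t, 0 < t → 0 < c t) :
    (extremalRL (WeakLeb 𝕜 μ κ) (Leb 𝕜 μ ∞) θ s c r b q a).Embeds
      (LorentzKaramataRL 𝕜 μ p s (fun t => c (t ^ (1 / κ))) r (fun t => b (t ^ (1 / κ))) q
        (fun t => a (t ^ (1 / κ)))) := by
  rw [extremalRL_eq_ofFinite _ _ hq hr hs ha hb hc, LorentzKaramataRL, hp]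
  simp only [normRL_rearr hκ]
  exact FunctionSpace.ofFinite_embeds_ofFinite fun f =>
    mul_le_mul_right (normRL_mono fun t ht => powRearr_le_peetreK hκ f ht) _

theorem lorentzKaramataRL_embeds_extremalRL_leb {α β : ℝ} (hκ : 0 < κ) {p : ℝ≥0∞}
    (hp : (p⁻¹).toReal = (1 - θ) / κ) (hq : q ≠ 0) (hr : r ≠ 0) (hs : s ≠ 0)
    (ha : UpperType α a) (hb : UpperType β b) (hαβ : α + β < θ) (hc : ∀ t, 0 < t → 0 < c t) :
    (LorentzKaramataRL 𝕜 μ p s (fun t => c (t ^ (1 / κ))) r (fun t => b (t ^ (1 / κ))) q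
        (fun t => a (t ^ (1 / κ)))).Embeds
      (extremalRL (Leb 𝕜 μ (ENNReal.ofReal κ)) (Leb 𝕜 μ ∞) θ s c r b q a) := by
  obtain ⟨ε, hε₀, hε⟩ := exists_between (sub_pos.2 hαβ)
  obtain ⟨C₁, hC₁⟩ := exists_peetreK_leb_le (μ := μ) (𝕜 := 𝕜) hκ hε₀
  obtain ⟨C₂, hC₂⟩ := exists_normRL_dyadicSup_le (σ := -θ) (s := s) (c := c) (r := r) (q := q)
    ha hb (ε := ε) (by linarith)
  rw [extremalRL_eq_ofFinite _ _ hq hr hs ha.pos hb.pos hc, LorentzKaramataRL, hp]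
  simp only [normRL_rearr hκ]
  set D : ℝ := κ ^ ((s⁻¹).toReal + (r⁻¹).toReal + (q⁻¹).toReal)
  have hD : 0 < D := Real.rpow_pos_of_pos hκ _
  refine FunctionSpace.ofFinite_embeds_ofFinite (C := C₁ * C₂ * D⁻¹.toNNReal) fun f => ?_
  calc normRL (-θ) s c r b q a (peetreK (Leb 𝕜 μ (ENNReal.ofReal κ)) (Leb 𝕜 μ ∞) f)
      ≤ C₁ * normRL (-θ) s c r b q a (dyadicSup ε (powRearr κ f)) :=
        (normRL_mono (hC₁ f)).trans (normRL_const_mul ENNReal.coe_ne_top).le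
    _ ≤ C₁ * (C₂ * normRL (-θ) s c r b q a (powRearr κ f)) := by
        gcongr
        exact hC₂ _ (measurable_powRearr κ f)
    _ = C₁ * C₂ * (ENNReal.ofReal D⁻¹ * ENNReal.ofReal D) *
          normRL (-θ) s c r b q a (powRearr κ f) := by
        rw [← ENNReal.ofReal_mul (by positivity), inv_mul_cancel₀ hD.ne', ENNReal.ofReal_one,
          mul_one, mul_assoc]
    _ = _ := by
        push_cast
        simp only [mul_assoc]
        rfl

end Spaces

end RLInterp

open RLInterp in
theorem theorem5p7_general {Ω : Type*} [MeasurableSpace Ω] (μ : Measure Ω) (𝕜 : Type*) [RCLike 𝕜]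
    (θ κ : ℝ) (hθ₁ : θ ≤ 1) (hκ : 0 < κ)
    (p : ℝ≥0∞) (hp : p = ENNReal.ofReal κ / ENNReal.ofReal (1 - θ))
    (q r s : ℝ≥0∞) (hq : 0 < q) (hr : 0 < r) (hs : 0 < s)
    (a b c : ℝ → ℝ) {α β : ℝ} (ha : UpperType α a) (hb : UpperType β b) (hαβ : α + β < θ)
    (hc : ∀ t, 0 < t → 0 < c t) :
    (extremalRL (Leb 𝕜 μ (ENNReal.ofReal κ)) (Leb 𝕜 μ ∞) θ s c r b q a).Same
      (extremalRL (WeakLeb 𝕜 μ κ) (Leb 𝕜 μ ∞) θ s c r b q a) ∧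
    (extremalRL (WeakLeb 𝕜 μ κ) (Leb 𝕜 μ ∞) θ s c r b q a).Same
      (LorentzKaramataRL 𝕜 μ p s (fun t => c (t ^ (1 / κ))) r (fun t => b (t ^ (1 / κ)))
        q (fun t => a (t ^ (1 / κ)))) := by
  have hp_inv : (p⁻¹).toReal = (1 - θ) / κ :=
    hp ▸ toReal_inv_ofReal_div_ofReal hκ (sub_nonneg.2 hθ₁)
  have h_leb_weak := extremalRL_leb_embeds_extremalRL_weakLeb (μ := μ) (𝕜 := 𝕜) (θ := θ) hκ
    hq.ne' hr.ne' hs.ne' ha.pos hb.pos hc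
  have h_weak_lk := extremalRL_weakLeb_embeds_lorentzKaramataRL (μ := μ) (𝕜 := 𝕜) hκ hp_inv
    hq.ne' hr.ne' hs.ne' ha.pos hb.pos hc
  have h_lk_leb := lorentzKaramataRL_embeds_extremalRL_leb (μ := μ) (𝕜 := 𝕜) hκ hp_inv
    hq.ne' hr.ne' hs.ne' ha hb hαβ hc
  exact ⟨⟨h_leb_weak, h_weak_lk.trans h_lk_leb⟩, h_weak_lk, h_lk_leb.trans h_leb_weak⟩

theorem theorem5p7 {Ω : Type*} [MeasurableSpace Ω] (μ : Measure Ω) [SigmaFinite μ]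
    (hμ : RLInterp.NonAtomic μ) (𝕜 : Type*) [RCLike 𝕜]
    (θ κ : ℝ) (hθ₀ : 0 < θ) (hθ₁ : θ ≤ 1) (hκ : 0 < κ)
    (p : ℝ≥0∞) (hp : p = ENNReal.ofReal κ / ENNReal.ofReal (1 - θ))
    (q r s : ℝ≥0∞) (hq : 0 < q) (hr : 0 < r) (hs : 0 < s)
    (a b c : ℝ → ℝ) (ha : RLInterp.SlowlyVarying a) (hb : RLInterp.SlowlyVarying b)
    (hc : RLInterp.SlowlyVarying c) :
    (RLInterp.extremalRL (RLInterp.Leb 𝕜 μ (ENNReal.ofReal κ)) (RLInterp.Leb 𝕜 μ ∞)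
        θ s c r b q a).Same
      (RLInterp.extremalRL (RLInterp.WeakLeb 𝕜 μ κ) (RLInterp.Leb 𝕜 μ ∞) θ s c r b q a) ∧
    (RLInterp.extremalRL (RLInterp.WeakLeb 𝕜 μ κ) (RLInterp.Leb 𝕜 μ ∞) θ s c r b q a).Same
      (RLInterp.LorentzKaramataRL 𝕜 μ p s (fun t => c (t ^ (1 / κ))) r (fun t => b (t ^ (1 / κ)))
        q (fun t => a (t ^ (1 / κ)))) :=
  theorem5p7_general μ 𝕜 θ κ hθ₁ hκ p hp q r s hq hr hs a b c (ha.upperType (by positivity))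
    (hb.upperType (by positivity)) (show θ / 3 + θ / 3 < θ by linarith) hc.pos
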